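/- Let $(W,S)$ be a Coxeter system with $S$ finite, $|S|=n$, and with orders $m_{st}\in\{1,2,\dots\}\cup\{\infty\}$. Let $B=(B_{st})_{s,t\in S}$ be a symmetric real matrix with $B_{st}=-\cos(\pi/m_{st})$ if $m_{st}<\infty$ and $B_{st}\le -1$ if $m_{st}=\infty$. Let $V$ be the real vector space with basis $\Delta=\{\alpha_s\}_{s\in S}$ (the simple roots), with the bilinear form $\mathcal B$ given by $\mathcal B(\alpha_s,\alpha_t)=B_{st}$, and let $W$ act on $V$ by letting $s\in S$ act as the reflection $x\mapsto x-2\frac{\mathcal B(x,\alpha_s)}{\mathcal B(\alpha_s,\alpha_s)}\alpha_s$. Assume that the system is Lorentzian, i.e. that $\mathcal B$ has signature $(n-1,1)$. Let $\Phi=W(\Delta)$ be the set of roots and $\Phi^+$ the set of roots that are non-negative combinations of $\Delta$. For $0\ne x\in V$ let $\widehat x$ be the line $\mathbb{R}x$, a point of the projective space $\mathbb{P}V$ with its usual topology, on which $W$ acts by $w\cdot\widehat x=\widehat{w(x)}$; for $X\subseteq V$ put $\widehat X=\{\widehat x : 0\neq x\in X\}$. The limit roots are the accumulation points of $\widehat\Phi$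 in $\mathbb{P}V$. A point $q\in\mathbb{P}V$ is said to arise from a base point $p\in\mathbb{P}V$ through a sequence $(g_k)$ in $W$ if the points $g_k\cdot p$ are pairwise distinct and converge to $q$. Let $\mathbf w=s_1s_2s_3\cdots$ be an infinite reduced word, i.e. a sequence in $S$ such that each prefix $w_k=s_1\cdots s_k$ ($k\ge 0$) is a reduced expression, and let $\operatorname{inv}(\mathbf w)$ be its inversion set, the set of positive roots of the form $w_{k-1}(\alpha_{s_k})$, $k\ge 1$. Then $\widehat{\operatorname{inv}(\mathbf w)}$ has exactly one accumulation point $\widehat\gamma(\mathbf w)$ in $\mathbb{P}V$, and $\widehat\gamma(\mathbf w)$ is a limit root. Moreover, $\widehat\gamma(\mathbf w)$ arises through the sequence of prefixes $(w_k)_{k\ge 0}$, i.e. it arises from some base point $p\in\mathbb{P}V$ through $(w_k)_{k\ge0}$; and for every projective root $p\in\widehat\Phi$ and every subsequence $(w_{k_j})_j$ of the prefixes for which the points $w_{k_j}\cdot p$ are pairwise distinct, $\widehat\gamma(\mathbf w)$ arises from $p$ through $(w_{k_j})_j$. -/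

import Mathlib

open scoped LinearAlgebra.Projectivization

namespace GeomCox

noncomputable section

/-- The real projective space `ℙ V` of lines in `V` carries the quotient topology of `V \ {0}`. -/
instance projTopology {S : Type*} : TopologicalSpace (ℙ ℝ (S → ℝ)) :=
  TopologicalSpace.coinduced (Projectivization.mk' ℝ) inferInstance

/-- The set of directions (lines) of the non-zero vectors of `X`. -/
def proj {S : Type*} (X : Set (S → ℝ)) : Set (ℙ ℝ (S → ℝ)) :=
  {p | ∃ x ∈ X, ∃ hx : x ≠ 0, p = Projectivization.mk ℝ x hx}

/-- `x` arises from the base point `x₀` through the sequence `g`: the points `g k • x₀` are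
pairwise distinct and converge to `x`. -/
def ArisesFromThrough {G X : Type*} [TopologicalSpace X] [SMul G X]
    (x x₀ : X) (g : ℕ → G) : Prop :=
  Function.Injective (fun k => g k • x₀) ∧
    Filter.Tendsto (fun k => g k • x₀) Filter.atTop (nhds x)

/-- `B` is a matrix associated with the Coxeter matrix `M`
(in which the entry `0` encodes `m_{st} = ∞`). -/
structure IsGeometric {S : Type*} (M : CoxeterMatrix S) (B : Matrix S S ℝ) : Prop where
  symm : ∀ s t, B s t = B t s
  finite : ∀ s t, M s t ≠ 0 → B s t = -Real.cos (Real.pi / (M s t : ℝ))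
  infinite : ∀ s t, M s t = 0 → B s t ≤ -1

lemma IsGeometric.diag {S : Type*} {M : CoxeterMatrix S} {B : Matrix S S ℝ}
    (hB : IsGeometric M B) (s : S) : B s s = 1 := by
  rw [hB.finite s s (by simp)]
  simp

variable {S : Type*} [Fintype S] [DecidableEq S]

/-- The bilinear form of `B` on `V = ℝ^S`. -/
def form (B : Matrix S S ℝ) : LinearMap.BilinForm ℝ (S → ℝ) := Matrix.toBilin' B

/-- The form of `B` has signature `(n - 1, 1)`, where `n = |S|`. -/
def IsLorentzian (B : Matrix S S ℝ) : Prop :=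
  sigPos (form B).toQuadraticMap + 1 = Fintype.card S ∧ sigNeg (form B).toQuadraticMap = 1

/-- The simple root `α_s`. -/
def simpleRoot (s : S) : S → ℝ := Pi.single s 1

/-- The linear functional `x ↦ 2 B(x, α) / B(α, α)`. -/
def coroot (B : Matrix S S ℝ) (α : S → ℝ) : Module.Dual ℝ (S → ℝ) :=
  (2 / form B α α) • (form B).flip α

lemma form_simpleRoot (B : Matrix S S ℝ) (s t : S) :
    form B (simpleRoot s) (simpleRoot t) = B s t := by
  simp [form, simpleRoot]

section Geometric

variable {M : CoxeterMatrix S} {B : Matrix S S ℝ}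

lemma IsGeometric.coroot_simpleRoot (hB : IsGeometric M B) (s t : S) :
    coroot B (simpleRoot s) (simpleRoot t) = 2 * B t s := by
  simp [coroot, form_simpleRoot, hB.diag]

/-- The reflection `x ↦ x - 2 B(x, α_s) / B(α_s, α_s) α_s`. -/
def simpleReflection (hB : IsGeometric M B) (s : S) : (S → ℝ) ≃ₗ[ℝ] (S → ℝ) :=
  Module.reflection (x := simpleRoot s) (f := coroot B (simpleRoot s))
    (by rw [hB.coroot_simpleRoot, hB.diag, mul_one])

lemma simpleReflection_apply (hB : IsGeometric M B) (s : S) (x : S → ℝ) :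
    simpleReflection hB s x =
      x - (2 * form B x (simpleRoot s) / form B (simpleRoot s) (simpleRoot s)) • simpleRoot s := by
  rw [simpleReflection, Module.reflection_apply]
  simp [coroot, form_simpleRoot, hB.diag]

/-- The reflections in the simple roots satisfy the Coxeter relations. -/
lemma isLiftable_simpleReflection (hB : IsGeometric M B) :
    M.IsLiftable (simpleReflection hB) := by
  intro s t
  by_cases h0 : M s t = 0
  · rw [h0, pow_zero]
  by_cases hst : s = t
  · subst hst
    rw [M.diagonal, pow_one]
    ext1 x
    exact Module.involutive_reflection _ x
  have h1 : M s t ≠ 1 := M.off_diagonal s t hst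
  have hBst := hB.finite s t h0
  have hBts := hB.symm s t
  ext1 z
  rw [simpleReflection, simpleReflection,
    Module.reflection_mul_reflection_pow_apply _ _ (M s t) z _ rfl,
    hB.coroot_simpleRoot, hB.coroot_simpleRoot, ← hBts]
  generalize hm : M s t = m at *
  by_cases h2 : m = 2
  · subst h2
    have : B s t = 0 := by rw [hBst]; simp
    rw [this]
    norm_num
    abel
  have hm3 : (3 : ℝ) ≤ m := by exact_mod_cast (by omega : 3 ≤ m)
  set θ : ℝ := Real.pi / m with hθ
  have hmθ : m * θ = Real.pi := by rw [hθ]; field_simp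
  have ht : 2 * B s t * (2 * B s t) - 2 = 2 * Real.cos (2 * θ) := by
    rw [hBst, Real.cos_two_mul]; ring
  have hsin : Real.sin (2 * θ) ≠ 0 := by
    have hpos : 0 < θ := div_pos Real.pi_pos (by linarith)
    have : 3 * θ ≤ Real.pi := by rw [← hmθ]; gcongr
    exact (Real.sin_pos_of_pos_of_lt_pi (by linarith) (by linarith)).ne'
  rw [ht]
  have hS := fun n : ℤ => Polynomial.Chebyshev.S_two_mul_real_cos (2 * θ) n
  rcases Nat.even_or_odd' m with ⟨k, hk | hk⟩
  · have e1 : ((m : ℤ) - 2) / 2 = k - 1 := by omega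
    have e2 : ((m : ℤ) - 1) / 2 = k - 1 := by omega
    have : (Polynomial.Chebyshev.S ℝ ((k : ℤ) - 1)).eval (2 * Real.cos (2 * θ)) = 0 := by
      have h := hS ((k : ℤ) - 1)
      have e : (((k : ℤ) - 1 : ℤ) + 1 : ℝ) * (2 * θ) = Real.pi := by
        rw [← hmθ, hk]; push_cast; ring
      rw [e, Real.sin_pi] at h
      exact (mul_eq_zero.mp h).resolve_right hsin
    rw [e1, e2, this]
    simp
  · have e1 : ((m : ℤ) - 1) / 2 = k := by omega
    have e2 : ((m : ℤ) - 3) / 2 = k - 1 := by omega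
    have e3 : (m : ℤ) / 2 = k := by omega
    have e4 : ((m : ℤ) - 2) / 2 = k - 1 := by omega
    have : (Polynomial.Chebyshev.S ℝ (k : ℤ)).eval (2 * Real.cos (2 * θ)) +
        (Polynomial.Chebyshev.S ℝ ((k : ℤ) - 1)).eval (2 * Real.cos (2 * θ)) = 0 := by
      have h := hS (k : ℤ)
      have h' := hS ((k : ℤ) - 1)
      have e : (((k : ℤ) : ℝ) + 1) * (2 * θ) = Real.pi + θ := by
        rw [← hmθ, hk]; push_cast; ring
      have e' : (((k : ℤ) - 1 : ℤ) + 1 : ℝ) * (2 * θ) = Real.pi - θ := by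
        rw [← hmθ, hk]; push_cast; ring
      rw [e, add_comm, Real.sin_add_pi] at h
      rw [e', Real.sin_pi_sub] at h'
      refine (mul_eq_zero.mp ?_).resolve_right hsin
      rw [add_mul, h, h', neg_add_cancel]
    rw [e1, e2, e3, e4, this]
    simp

variable {W : Type*} [Group W]

/-- The geometric representation `ρ : W → GL(V)`, `s ↦ σ_{α_s}`. -/
def rho (cs : CoxeterSystem M W) (hB : IsGeometric M B) : W →* ((S → ℝ) ≃ₗ[ℝ] (S → ℝ)) :=
  cs.lift ⟨simpleReflection hB, isLiftable_simpleReflection hB⟩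

/-- The set `Φ` of roots, the orbit of the simple roots under `W`. -/
def roots (cs : CoxeterSystem M W) (hB : IsGeometric M B) : Set (S → ℝ) :=
  {γ | ∃ (w : W) (s : S), γ = rho cs hB w (simpleRoot s)}

/-- The positive roots: the roots with non-negative coordinates in the basis of simple roots. -/
def posRoots (cs : CoxeterSystem M W) (hB : IsGeometric M B) : Set (S → ℝ) :=
  {γ ∈ roots cs hB | ∀ s, 0 ≤ γ s}

/-- The set of limit roots: the accumulation points of the directions of roots. -/
def limitRoots (cs : CoxeterSystem M W) (hB : IsGeometric M B) : Set (ℙ ℝ (S → ℝ)) :=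
  derivedSet (proj (roots cs hB))

end Geometric

/-- The prefix `s_1 ... s_k` of an infinite word; the letter `s_{i+1}` is `a i`. -/
def wordPrefix {S : Type*} (a : ℕ → S) (k : ℕ) : List S := (List.range k).map a

/-- An infinite word is reduced if every finite prefix is a reduced expression. -/
def IsInfReduced {S W : Type*} [Group W] {M : CoxeterMatrix S} (cs : CoxeterSystem M W)
    (a : ℕ → S) : Prop :=
  ∀ k, cs.IsReduced (wordPrefix a k)

/-- The element `w_k = s_1 ... s_k` of `W`. -/
def prefixElt {S W : Type*} [Group W] {M : CoxeterMatrix S} (cs : CoxeterSystem M W)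
    (a : ℕ → S) (k : ℕ) : W :=
  cs.wordProd (wordPrefix a k)

/-- The inversion set of an infinite word: the positive roots `w_k(α_{s_{k+1}})`, `k ≥ 0`. -/
def invSet {M : CoxeterMatrix S} {B : Matrix S S ℝ} {W : Type*} [Group W]
    (cs : CoxeterSystem M W) (hB : IsGeometric M B) (a : ℕ → S) : Set (S → ℝ) :=
  {γ ∈ posRoots cs hB | ∃ k, γ = rho cs hB (prefixElt cs a k) (simpleRoot (a k))}

end

end GeomCox

/-! Since `B` is nondegenerate there is a vector `y` with product `1` with every simple root, an
interior point of the fundamental chamber. Applying a prefix to it telescopes: `-w_k y` is twice the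
sum of the first `k` inversions, minus `y` (`rho_prefixElt_eq`). Inversions are positive roots, and
pairwise distinct roots leave every bounded set (`tendsto_norm_roots`), so `-w_k y` diverges. Let
`u` be a limit of its normalizations. Then `u` is non-negative, being a limit of sums of positive
roots; it is isotropic, since `W` preserves the form; and it has non-negative product with every
inversion, hence with every other such limit.

In Lorentzian signature two isotropic vectors in the same half of the light cone have non-positive
product, and product zero only if they are proportional (`IsLorentzian.smul_eq_smul_of_isotropic`).
A Perron–Frobenius vector (`IsLorentzian.exists_nonneg_timelike`) puts all the limits in one half,
so they span a single line.

The same rigidity handles every other sequence (`IsLimitDirection.tendsto_mk`): if `x_k` diverges in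
norm while its square and its product with `w_k y` stay bounded, its limit directions are isotropic
and orthogonal to that line, hence equal to it. This applies to the inversions, to `w_k y`, and to
the images `w_k β` of a root `β`, along subsequences as well. -/

namespace GeomCox

/-! ### Coefficients of roots in rank two -/

/-- The Chebyshev-like sequence of coefficients of roots in a rank two root system. -/
noncomputable def dihedralCoeff (c : ℝ) : ℕ → ℝ
  | 0 => 0
  | 1 => 1
  | n + 2 => 2 * c * dihedralCoeff c (n + 1) - dihedralCoeff c n

lemma dihedralCoeff_nonneg_of_one_le {c : ℝ} (hc : 1 ≤ c) (n : ℕ) :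
    0 ≤ dihedralCoeff c n ∧ dihedralCoeff c n ≤ dihedralCoeff c (n + 1) := by
  induction n with
  | zero => simp [dihedralCoeff]
  | succ n ih =>
    refine ⟨ih.1.trans ih.2, ?_⟩
    rw [dihedralCoeff]
    nlinarith [ih.1, ih.2]

/-- The addition formulas give sin(nθ) the same recursion. Multiplying by sin θ avoids a division
and lets the sign be read off while nθ ≤ π. -/
lemma dihedralCoeff_cos_mul_sin (θ : ℝ) (n : ℕ) :
    dihedralCoeff (Real.cos θ) n * Real.sin θ = Real.sin (n * θ) := by
  induction n using Nat.twoStepInduction with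
  | zero => simp [dihedralCoeff]
  | one => simp [dihedralCoeff]
  | more n ih ih' =>
    rw [dihedralCoeff, sub_mul, mul_assoc, ih, ih']
    push_cast
    have h1 : ((n : ℝ) + 2) * θ = (n + 1) * θ + θ := by ring
    have h2 : (n : ℝ) * θ = (n + 1) * θ - θ := by ring
    rw [h1, h2, Real.sin_add, Real.sin_sub]
    ring

lemma dihedralCoeff_cos_nonneg {m n : ℕ} (hm : 2 ≤ m) (hn : n ≤ m) :
    0 ≤ dihedralCoeff (Real.cos (Real.pi / m)) n := by
  have hm' : (2 : ℝ) ≤ m := by exact_mod_cast hm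
  have hpos : 0 < Real.pi / m := div_pos Real.pi_pos (by linarith)
  have hlt : Real.pi / m < Real.pi := div_lt_self Real.pi_pos (by linarith)
  have hsin := Real.sin_pos_of_pos_of_lt_pi hpos hlt
  refine nonneg_of_mul_nonneg_left ?_ hsin
  rw [dihedralCoeff_cos_mul_sin]
  refine Real.sin_nonneg_of_nonneg_of_le_pi (by positivity) ?_
  have hn' : (n : ℝ) ≤ m := by exact_mod_cast hn
  calc (n : ℝ) * (Real.pi / m) ≤ m * (Real.pi / m) := by gcongr
    _ = Real.pi := by field_simp

/-! ### The geometric representation and the sign of roots -/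

section

variable {S : Type*} [Fintype S] [DecidableEq S] {M : CoxeterMatrix S} {B : Matrix S S ℝ}

omit [Fintype S] [DecidableEq S] in
lemma IsGeometric.dihedralCoeff_nonneg (hB : IsGeometric M B) {s t : S} (hst : s ≠ t) {n : ℕ}
    (hn : M s t ≠ 0 → n ≤ M s t) : 0 ≤ dihedralCoeff (-B s t) n := by
  by_cases h0 : M s t = 0
  · exact (dihedralCoeff_nonneg_of_one_le (by linarith [hB.infinite s t h0]) n).1
  · rw [hB.finite s t h0, neg_neg]
    have := M.off_diagonal s t hst
    exact dihedralCoeff_cos_nonneg (by omega) (hn h0)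

omit [Fintype S] [DecidableEq S] in
lemma IsGeometric.offDiag_nonpos (hB : IsGeometric M B) {s t : S} (hst : s ≠ t) : B s t ≤ 0 := by
  have h := hB.dihedralCoeff_nonneg hst (n := 2) (fun h0 => by
    have := M.off_diagonal s t hst
    omega)
  simp only [dihedralCoeff] at h
  linarith

lemma IsGeometric.form_comm (hB : IsGeometric M B) (x y : S → ℝ) : form B x y = form B y x := by
  simp only [form, Matrix.toBilin'_apply]
  rw [Finset.sum_comm]
  refine Finset.sum_congr rfl fun i _ => Finset.sum_congr rfl fun j _ => ?_
  rw [hB.symm j i]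
  ring

lemma IsGeometric.simpleReflection_eq (hB : IsGeometric M B) (s : S) (x : S → ℝ) :
    simpleReflection hB s x = x - (2 * form B x (simpleRoot s)) • simpleRoot s := by
  rw [simpleReflection_apply, form_simpleRoot, hB.diag, div_one]

lemma IsGeometric.form_simpleReflection (hB : IsGeometric M B) (s : S) (x y : S → ℝ) :
    form B (simpleReflection hB s x) (simpleReflection hB s y) = form B x y := by
  simp only [hB.simpleReflection_eq, map_sub, map_smul, LinearMap.sub_apply, LinearMap.smul_apply,
    smul_eq_mul, form_simpleRoot, hB.diag, hB.form_comm (simpleRoot s) y]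
  ring

variable {W : Type*} [Group W] (cs : CoxeterSystem M W) (hB : IsGeometric M B)

lemma rho_simple (s : S) : rho cs hB (cs.simple s) = simpleReflection hB s :=
  cs.lift_apply_simple _ s

lemma rho_mul_apply (v w : W) (x : S → ℝ) :
    rho cs hB (v * w) x = rho cs hB v (rho cs hB w x) := by
  rw [map_mul]; rfl

lemma rho_one_apply (x : S → ℝ) : rho cs hB 1 x = x := by
  rw [map_one]; rfl

lemma rho_inv_rho_apply (w : W) (x : S → ℝ) : rho cs hB w⁻¹ (rho cs hB w x) = x := by
  rw [← rho_mul_apply, inv_mul_cancel, rho_one_apply]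

lemma rho_rho_inv_apply (w : W) (x : S → ℝ) : rho cs hB w (rho cs hB w⁻¹ x) = x := by
  rw [← rho_mul_apply, mul_inv_cancel, rho_one_apply]

lemma rho_simple_apply (s : S) (x : S → ℝ) :
    rho cs hB (cs.simple s) x = x - (2 * form B x (simpleRoot s)) • simpleRoot s := by
  rw [rho_simple, hB.simpleReflection_eq]

lemma rho_simple_simpleRoot (s : S) :
    rho cs hB (cs.simple s) (simpleRoot s) = -simpleRoot s := by
  rw [rho_simple_apply, form_simpleRoot, hB.diag]
  module

/-- The geometric representation preserves the form. -/
lemma form_rho (w : W) (x y : S → ℝ) :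
    form B (rho cs hB w x) (rho cs hB w y) = form B x y := by
  induction w using cs.simple_induction_left generalizing x y with
  | one => simp only [rho_one_apply]
  | mul_simple_left w i ih =>
    rw [rho_mul_apply, rho_mul_apply, rho_simple, hB.form_simpleReflection, ih]

lemma form_rho_left (w : W) (x y : S → ℝ) :
    form B (rho cs hB w x) y = form B x (rho cs hB w⁻¹ y) := by
  rw [← form_rho cs hB w x, rho_rho_inv_apply]

/-- The action of an alternating word on a simple root. -/
lemma rho_alternatingWord (s t : S) (k : ℕ) :
    rho cs hB (cs.wordProd (CoxeterSystem.alternatingWord s t k)) (simpleRoot s) =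
      dihedralCoeff (-B s t) (k + 1) • simpleRoot (if Even k then s else t) +
      dihedralCoeff (-B s t) k • simpleRoot (if Even k then t else s) := by
  induction k with
  | zero => simp [CoxeterSystem.alternatingWord, dihedralCoeff, map_one]
  | succ k ih =>
    rw [CoxeterSystem.alternatingWord_succ', cs.wordProd_cons, rho_mul_apply, ih, map_add,
      map_smul, map_smul, rho_simple_simpleRoot, rho_simple_apply, form_simpleRoot, dihedralCoeff]
    have := hB.symm s t
    by_cases hk : Even k
    · simp only [hk, if_true, Nat.even_add_one, not_true, if_false]
      module
    · simp only [hk, if_false, Nat.even_add_one, not_false_eq_true, if_true, ← this]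
      module

omit [Fintype S] in
lemma simpleRoot_nonneg (s : S) : 0 ≤ simpleRoot s :=
  Pi.single_nonneg.2 zero_le_one

/-- If `ℓ (w s) > ℓ w` then `w α_s` is non-negative. -/
theorem rho_simpleRoot_nonneg (w : W) (s : S) (hs : ¬ cs.IsRightDescent w s) :
    0 ≤ rho cs hB w (simpleRoot s) := by
  classical
  induction hn : cs.length w using Nat.strong_induction_on generalizing w s with
  | _ n ih =>
  by_cases hw : w = 1
  · rw [hw, rho_one_apply]
    exact simpleRoot_nonneg s
  obtain ⟨t, ht⟩ := cs.exists_rightDescent_of_ne_one hw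
  have hst : s ≠ t := by
    rintro rfl
    exact hs ht
  rw [cs.not_isRightDescent_iff] at hs
  rw [cs.isRightDescent_iff] at ht
  -- Split off from the right of `w` the longest alternating word in `s`, `t` ending in `t` whose
  -- length adds to that of the remaining factor `v`.
  let P : ℕ → Prop := fun k =>
    ∃ v, w = v * cs.wordProd (CoxeterSystem.alternatingWord s t k) ∧ cs.length v + k = cs.length w
  have hP1 : P 1 := ⟨w * cs.simple t, by simp [CoxeterSystem.alternatingWord], ht⟩
  set k := Nat.findGreatest P (cs.length w) with hk
  have hk1 : 1 ≤ k := Nat.le_findGreatest (by omega) hP1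
  obtain ⟨v, hv, hvk⟩ : P k := Nat.findGreatest_spec (P := P) (m := 1) (by omega) hP1
  have hmax : ¬ P (k + 1) := by
    intro h
    have hle : k + 1 ≤ cs.length w := by
      obtain ⟨v', _, h⟩ := h
      omega
    have := Nat.le_findGreatest hle h
    omega
  -- Neither `s` nor `t` is a right descent of `v`: one would extend the alternating word, against
  -- maximality of `k`; the other would give an expression of `w` that is too short.
  have hfront : ¬ cs.IsRightDescent v (if Even k then t else s) := by
    intro h
    rw [cs.isRightDescent_iff] at h
    refine hmax ⟨v * cs.simple (if Even k then t else s), ?_, by omega⟩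
    rw [CoxeterSystem.alternatingWord_succ', cs.wordProd_cons, mul_assoc,
      cs.simple_mul_simple_cancel_left, hv]
  have hback : ¬ cs.IsRightDescent v (if Even k then s else t) := by
    intro h
    rw [cs.isRightDescent_iff] at h
    obtain ⟨j, hj⟩ : ∃ j, k = j + 1 := ⟨k - 1, by omega⟩
    have hlet : (if Even k then s else t) = (if Even j then t else s) := by
      rw [hj]
      by_cases hje : Even j <;> simp [hje, Nat.even_add_one]
    rw [hlet] at h
    rw [hj, CoxeterSystem.alternatingWord_succ', cs.wordProd_cons, ← mul_assoc] at hv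
    have h1 := cs.length_mul_le (v * cs.simple (if Even j then t else s))
      (cs.wordProd (CoxeterSystem.alternatingWord s t j))
    have h2 := cs.length_wordProd_le (CoxeterSystem.alternatingWord s t j)
    rw [← hv] at h1
    rw [CoxeterSystem.length_alternatingWord] at h2
    omega
  -- Appending `s` lengthens `w`, so the alternating word of length `k + 1` is reduced. This bounds
  -- `k + 1` by the order of `st` and makes both rank two coefficients non-negative.
  have hred : cs.IsReduced (CoxeterSystem.alternatingWord t s (k + 1)) := by
    have h1 : w * cs.simple s = v * cs.wordProd (CoxeterSystem.alternatingWord t s (k + 1)) := by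
      rw [CoxeterSystem.alternatingWord_succ, cs.wordProd_concat, ← mul_assoc, ← hv]
    have h2 := cs.length_mul_le v (cs.wordProd (CoxeterSystem.alternatingWord t s (k + 1)))
    have h3 := cs.length_wordProd_le (CoxeterSystem.alternatingWord t s (k + 1))
    rw [← h1] at h2
    unfold CoxeterSystem.IsReduced
    rw [CoxeterSystem.length_alternatingWord] at h3 ⊢
    omega
  have hkM : M s t ≠ 0 → k + 1 ≤ M s t := by
    intro h0
    by_contra hlt
    rw [M.symmetric] at h0 hlt
    exact cs.not_isReduced_alternatingWord t s h0 (by omega) hred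
  have h1 := hB.dihedralCoeff_nonneg hst hkM
  have h2 := hB.dihedralCoeff_nonneg hst (n := k) (fun h => by have := hkM h; omega)
  rw [hv, rho_mul_apply, rho_alternatingWord, map_add, map_smul, map_smul]
  have hlt : cs.length v < n := by omega
  exact add_nonneg (smul_nonneg h1 (ih _ hlt v _ hback rfl))
    (smul_nonneg h2 (ih _ hlt v _ hfront rfl))

/-- If `ℓ (w s) < ℓ w` then `w α_s` is non-positive. -/
theorem rho_simpleRoot_nonpos (w : W) (s : S) (hs : cs.IsRightDescent w s) :
    rho cs hB w (simpleRoot s) ≤ 0 := by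
  rw [cs.isRightDescent_iff_not_isRightDescent_mul] at hs
  have h := rho_simpleRoot_nonneg cs hB _ s hs
  rw [rho_mul_apply, rho_simple_simpleRoot, map_neg] at h
  exact neg_nonneg.1 h

/-! ### Infinite reduced words -/

/-- The `k`-th root of the inversion set of an infinite word. -/
noncomputable def invRoot (a : ℕ → S) (k : ℕ) : S → ℝ :=
  rho cs hB (prefixElt cs a k) (simpleRoot (a k))

omit [Fintype S] [DecidableEq S] in
lemma prefixElt_succ (a : ℕ → S) (k : ℕ) :
    prefixElt cs a (k + 1) = prefixElt cs a k * cs.simple (a k) := by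
  simp [prefixElt, wordPrefix, List.range_succ, cs.wordProd_append]

omit [Fintype S] [DecidableEq S] in
lemma prefixElt_zero (a : ℕ → S) : prefixElt cs a 0 = 1 := by
  simp [prefixElt, wordPrefix]

omit [Fintype S] [DecidableEq S] in
lemma IsInfReduced.length_prefixElt {cs : CoxeterSystem M W} {a : ℕ → S}
    (ha : IsInfReduced cs a) (k : ℕ) : cs.length (prefixElt cs a k) = k := by
  have := ha k
  unfold CoxeterSystem.IsReduced at this
  simpa [prefixElt, wordPrefix] using this

variable {cs} {a : ℕ → S}

lemma IsInfReduced.invRoot_nonneg (ha : IsInfReduced cs a) (k : ℕ) :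
    0 ≤ invRoot cs hB a k := by
  refine rho_simpleRoot_nonneg cs hB _ _ ?_
  rw [cs.not_isRightDescent_iff, ← prefixElt_succ, ha.length_prefixElt, ha.length_prefixElt]

lemma IsInfReduced.rho_inv_invRoot_nonpos (ha : IsInfReduced cs a) {j k : ℕ} (hjk : j < k) :
    rho cs hB (prefixElt cs a k)⁻¹ (invRoot cs hB a j) ≤ 0 := by
  rw [invRoot, ← rho_mul_apply]
  refine rho_simpleRoot_nonpos cs hB _ _ ?_
  -- Up to inversion this is the factor between two prefixes; it is reduced because the whole word
  -- is.
  have key : ∀ i j : ℕ, i ≤ j →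
      cs.length ((prefixElt cs a j)⁻¹ * prefixElt cs a i) = j - i := by
    intro i j hij
    apply le_antisymm
    · induction j, hij using Nat.le_induction with
      | base => simp
      | succ j hij ih =>
        rw [prefixElt_succ, mul_inv_rev, cs.inv_simple, mul_assoc]
        have := cs.length_mul_le (cs.simple (a j)) ((prefixElt cs a j)⁻¹ * prefixElt cs a i)
        rw [cs.length_simple] at this
        omega
    · have := cs.length_le_length_mul_add_right (prefixElt cs a j)⁻¹ (prefixElt cs a i)
      rw [cs.length_inv, ha.length_prefixElt, ha.length_prefixElt] at this
      omega
  rw [cs.isRightDescent_iff, mul_assoc, ← prefixElt_succ, key _ _ hjk, key _ _ hjk.le]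
  omega

end

/-! ### Lorentzian geometry -/

section

variable {S : Type*} [Fintype S] [DecidableEq S] {M : CoxeterMatrix S} {B : Matrix S S ℝ}

lemma form_apply (B : Matrix S S ℝ) (x y : S → ℝ) :
    form B x y = ∑ i, ∑ j, x i * B i j * y j := by
  simp [form, Matrix.toBilin'_apply]

lemma continuous_form (B : Matrix S S ℝ) :
    Continuous fun p : (S → ℝ) × (S → ℝ) => form B p.1 p.2 := by
  simp only [form_apply]
  fun_prop

lemma tendsto_form (B : Matrix S S ℝ) {ι : Type*} {l : Filter ι} {f g : ι → S → ℝ} {x y : S → ℝ}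
    (hf : Filter.Tendsto f l (nhds x)) (hg : Filter.Tendsto g l (nhds y)) :
    Filter.Tendsto (fun i => form B (f i) (g i)) l (nhds (form B x y)) := by
  simp only [form_apply]
  rw [tendsto_pi_nhds] at hf hg
  exact tendsto_finsetSum _ fun i _ => tendsto_finsetSum _ fun j _ =>
    ((hf i).mul_const _).mul (hg j)

lemma form_smul_smul (B : Matrix S S ℝ) (c d : ℝ) (x y : S → ℝ) :
    form B (c • x) (d • y) = c * d * form B x y := by
  simp only [map_smul, LinearMap.smul_apply, smul_eq_mul]
  ring

/-- The orthogonal complement of a timelike vector is positive definite. -/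
lemma IsLorentzian.form_self_pos (hB : IsGeometric M B) (hL : IsLorentzian B) {e x : S → ℝ}
    (he : form B e e < 0) (hex : form B e x = 0) (hx : x ≠ 0) : 0 < form B x x := by
  by_contra! hle
  -- Otherwise `e` and `x` would span a plane on which the form is non-positive, too large for
  -- positive index `n - 1`.
  have hli : LinearIndependent ℝ ![e, x] := by
    refine LinearIndependent.pair_iff.2 fun a b hab => ?_
    have h1 : a * form B e e = 0 := by
      have := congrArg (form B e) hab
      simpa [hex] using this
    have ha : a = 0 := by simpa [he.ne] using h1
    subst ha
    simpa [hx] using hab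
  have hrank : Module.finrank ℝ (Submodule.span ℝ (Set.range ![e, x])) = 2 := by
    simpa using finrank_span_eq_card hli
  have hneg : ∀ v ∈ Submodule.span ℝ (Set.range ![e, x]), form B v v ≤ 0 := by
    intro v hv
    rw [Matrix.range_cons, Matrix.range_cons, Matrix.range_empty, Set.union_empty,
      Set.singleton_union, Submodule.mem_span_pair] at hv
    obtain ⟨a, b, rfl⟩ := hv
    simp only [map_add, map_smul, LinearMap.add_apply, LinearMap.smul_apply, smul_eq_mul, hex,
      hB.form_comm x e]
    nlinarith [mul_nonneg (sq_nonneg a) (neg_nonneg.2 he.le),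
      mul_nonneg (sq_nonneg b) (neg_nonneg.2 hle)]
  have h := QuadraticForm.sigPos_add_finrank_le_of_nonpos (Q := (form B).toQuadraticMap)
    (V := Submodule.span ℝ (Set.range ![e, x])) (by
      intro v hv
      simpa using hneg v hv)
  rw [hrank, Module.finrank_fintype_fun_eq_card] at h
  have := hL.1
  omega

/-- Two isotropic vectors in the same half of the light cone, with non-negative product, are
proportional. -/
lemma IsLorentzian.smul_eq_smul_of_isotropic (hB : IsGeometric M B) (hL : IsLorentzian B)
    {e u v : S → ℝ} (he : form B e e < 0) (hu : form B u u = 0) (hv : form B v v = 0)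
    (h : 0 ≤ form B e u * form B e v * form B u v) :
    form B e u • v = form B e v • u := by
  by_contra hne
  -- This combination is orthogonal to `e`, and its square is -2 times the product assumed
  -- non-negative.
  have hpos := hL.form_self_pos hB he (x := form B e u • v - form B e v • u)
    (by simp; ring) (sub_ne_zero.2 hne)
  simp only [map_sub, map_smul, LinearMap.sub_apply, LinearMap.smul_apply, smul_eq_mul, hu, hv,
      hB.form_comm v u] at hpos
  nlinarith

/-- Timelike vectors in the same half as a common timelike vector are in the same half. -/
lemma IsLorentzian.form_neg_of_timelike (hB : IsGeometric M B) (hL : IsLorentzian B)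
    {x y z : S → ℝ} (hx : form B x x < 0) (hy : form B y y < 0) (hz : form B z z < 0)
    (hxy : form B x y < 0) (hxz : form B x z < 0) : form B y z < 0 := by
  by_contra! h
  have hneg : form B (form B x y • z - form B x z • y) (form B x y • z - form B x z • y) < 0 := by
    simp only [map_sub, map_smul, LinearMap.sub_apply, LinearMap.smul_apply, smul_eq_mul,
      hB.form_comm z y]
    nlinarith [mul_nonneg (mul_pos_of_neg_of_neg hxy hxz).le h,
      mul_pos (mul_pos_of_neg_of_neg hxy hxy) (neg_pos.2 hz),
      mul_pos (mul_pos_of_neg_of_neg hxz hxz) (neg_pos.2 hy)]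
  have hpos := hL.form_self_pos hB hx (x := form B x y • z - form B x z • y)
    (by simp; ring) (by rintro h0; rw [h0] at hneg; simp at hneg)
  linarith

lemma IsLorentzian.exists_timelike (hL : IsLorentzian B) : ∃ x, form B x x < 0 := by
  obtain ⟨V, hV, hneg⟩ := exists_finrank_eq_sigPos_and_posDef (-(form B).toQuadraticMap)
  rw [sigPos_neg, hL.2] at hV
  have : Nontrivial V := Module.nontrivial_of_finrank_pos (R := ℝ) (by omega)
  obtain ⟨v, hv⟩ := exists_ne (0 : V)
  refine ⟨v, ?_⟩
  simpa using hneg v hv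

/-- There is a vector having product `1` with every simple root. -/
lemma IsLorentzian.exists_form_simpleRoot_eq_one (hB : IsGeometric M B) (hL : IsLorentzian B) :
    ∃ y, ∀ s, form B y (simpleRoot s) = 1 := by
  obtain ⟨e, he⟩ := hL.exists_timelike
  -- A vector in the radical would be orthogonal to a timelike vector and hence have positive
  -- square, so the form is nondegenerate.
  let f : (S → ℝ) →ₗ[ℝ] (S → ℝ) := LinearMap.pi fun s => (form B).flip (simpleRoot s)
  have hf : Function.Injective f := by
    rw [injective_iff_map_eq_zero]
    intro x hx
    have hx' : ∀ z, form B x z = 0 := by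
      have h0 : form B x = 0 := by
        refine (Pi.basisFun ℝ S).ext fun s => ?_
        simpa [f, simpleRoot] using congrFun hx s
      intro z
      rw [h0, LinearMap.zero_apply]
    by_contra hne
    have := hL.form_self_pos hB he (by rw [hB.form_comm, hx']) hne
    rw [hx'] at this
    exact lt_irrefl _ this
  obtain ⟨y, hy⟩ := (LinearMap.injective_iff_surjective.1 hf) 1
  exact ⟨y, fun s => by simpa [f] using congrFun hy s⟩

lemma form_eq_sum {y : S → ℝ} (hy : ∀ s, form B y (simpleRoot s) = 1) (x : S → ℝ) :
    form B y x = ∑ s, x s := by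
  conv_lhs => rw [pi_eq_sum_univ' x]
  rw [map_sum]
  refine Finset.sum_congr rfl fun s _ => ?_
  rw [map_smul, ← simpleRoot, hy, smul_eq_mul, mul_one]

/-- Diagonal terms do not change, and off-diagonal entries of `B` are non-positive. -/
lemma IsGeometric.form_abs_le (hB : IsGeometric M B) (x : S → ℝ) :
    form B |x| |x| ≤ form B x x := by
  simp only [form_apply]
  refine Finset.sum_le_sum fun i _ => Finset.sum_le_sum fun j _ => ?_
  simp only [Pi.abs_apply]
  by_cases hij : i = j
  · subst hij
    rw [hB.diag, mul_one, mul_one, abs_mul_abs_self]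
  · have h1 := hB.offDiag_nonpos hij
    have h2 : x i * x j ≤ |x i| * |x j| := by
      rw [← abs_mul]
      exact le_abs_self _
    nlinarith

/-- A Perron–Frobenius vector: there is a non-negative timelike vector whose product with every
non-negative vector is non-positive. -/
lemma IsLorentzian.exists_nonneg_timelike (hB : IsGeometric M B) (hL : IsLorentzian B) :
    ∃ e : S → ℝ, 0 ≤ e ∧ form B e e < 0 ∧ ∀ x : S → ℝ, 0 ≤ x → form B e x ≤ 0 := by
  obtain ⟨x₀, hx₀⟩ := hL.exists_timelike
  let K : Set (S → ℝ) := {x | x ⬝ᵥ x = 1}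
  have hK : IsCompact K := by
    refine Metric.isCompact_of_isClosed_isBounded
      (isClosed_eq (by fun_prop) continuous_const) ?_
    refine (Metric.isBounded_closedBall (x := (0 : S → ℝ)) (r := 1)).subset fun x hx => ?_
    rw [mem_closedBall_zero_iff, pi_norm_le_iff_of_nonneg zero_le_one]
    intro i
    have h1 : x i * x i ≤ x ⬝ᵥ x :=
      Finset.single_le_sum (f := fun i => x i * x i) (fun j _ => mul_self_nonneg _)
        (Finset.mem_univ i)
    have h2 : x ⬝ᵥ x = 1 := hx
    rw [Real.norm_eq_abs, abs_le_one_iff_mul_self_le_one]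
    linarith
  have hscale : ∀ x : S → ℝ, x ≠ 0 → ∃ c : ℝ, 0 < c ∧ c * c * (x ⬝ᵥ x) = 1 := by
    intro x hx
    have hpos : 0 < x ⬝ᵥ x :=
      lt_of_le_of_ne (Finset.sum_nonneg fun i _ => mul_self_nonneg _)
        (fun h => hx (dotProduct_self_eq_zero.1 h.symm))
    refine ⟨(Real.sqrt (x ⬝ᵥ x))⁻¹, inv_pos.2 (Real.sqrt_pos.2 hpos), ?_⟩
    rw [← mul_inv, Real.mul_self_sqrt hpos.le, inv_mul_cancel₀ hpos.ne']
  have hx₀0 : x₀ ≠ 0 := by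
    rintro rfl
    simp at hx₀
  obtain ⟨c₀, hc₀, hc₀1⟩ := hscale x₀ hx₀0
  have hmem₀ : c₀ • x₀ ∈ K := by
    change c₀ • x₀ ⬝ᵥ c₀ • x₀ = 1
    rw [smul_dotProduct, dotProduct_smul, smul_eq_mul, smul_eq_mul, ← mul_assoc, hc₀1]
  have hcont : ContinuousOn (fun x => form B x x) K :=
    ((continuous_form B).comp (continuous_id.prodMk continuous_id)).continuousOn
  -- Minimize over the Euclidean unit sphere. The absolute value `|z|` is again a minimizer, hence
  -- an eigenvector, with the negative minimum as eigenvalue.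
  obtain ⟨z, hzK, hz⟩ := hK.exists_isMinOn ⟨_, hmem₀⟩ hcont
  set m := form B z z with hm
  have hmneg : m < 0 := by
    have h1 : m ≤ form B (c₀ • x₀) (c₀ • x₀) := hz hmem₀
    rw [form_smul_smul] at h1
    nlinarith [mul_pos hc₀ hc₀]
  have hge : ∀ x : S → ℝ, m * (x ⬝ᵥ x) ≤ form B x x := by
    intro x
    by_cases hx : x = 0
    · simp [hx]
    obtain ⟨c, hc, hc1⟩ := hscale x hx
    have hmem : c • x ∈ K := by
      change c • x ⬝ᵥ c • x = 1
      rw [smul_dotProduct, dotProduct_smul, smul_eq_mul, smul_eq_mul, ← mul_assoc, hc1]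
    have h1 : m ≤ form B (c • x) (c • x) := hz hmem
    rw [form_smul_smul] at h1
    have hcc := mul_pos hc hc
    refine le_of_mul_le_mul_left ?_ hcc
    calc c * c * (m * (x ⬝ᵥ x)) = m * (c * c * (x ⬝ᵥ x)) := by ring
      _ = m := by rw [hc1, mul_one]
      _ ≤ _ := h1
  have habs : |z| ⬝ᵥ |z| = 1 := by
    rw [← (hzK : z ⬝ᵥ z = 1)]
    exact Finset.sum_congr rfl fun i _ => abs_mul_abs_self _
  have hself : form B |z| |z| = m := by
    refine le_antisymm (hB.form_abs_le z) ?_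
    simpa [habs] using hge |z|
  have heig : ∀ x : S → ℝ, form B |z| x = m * (|z| ⬝ᵥ x) := by
    intro x
    set b := form B |z| x - m * (|z| ⬝ᵥ x) with hb
    set c := form B x x - m * (x ⬝ᵥ x) with hc
    have hc0 : 0 ≤ c := sub_nonneg.2 (hge x)
    have hquad : ∀ t : ℝ, 0 ≤ 2 * t * b + t * t * c := by
      intro t
      have h1 := hge (|z| + t • x)
      simp only [map_add, map_smul, LinearMap.add_apply, LinearMap.smul_apply, smul_eq_mul,
        add_dotProduct, dotProduct_add, smul_dotProduct, dotProduct_smul, habs, hself,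
        hB.form_comm x |z|, dotProduct_comm x |z|] at h1
      rw [hb, hc]
      linarith
    -- This choice makes the quadratic negative unless `b = 0`; the `+ 1` covers `c = 0`.
    have h1 := hquad (-b / (c + 1))
    have h2 : 2 * (-b / (c + 1)) * b + -b / (c + 1) * (-b / (c + 1)) * c =
        -(b * b * ((c + 2) / (c + 1) ^ 2)) := by
      field_simp
      ring
    rw [h2] at h1
    have h3 : 0 < (c + 2) / (c + 1) ^ 2 := by positivity
    have h4 : b * b = 0 := by
      by_contra hne
      have := mul_pos (lt_of_le_of_ne (mul_self_nonneg b) (Ne.symm hne)) h3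
      linarith
    have h5 : b = 0 := mul_self_eq_zero.1 h4
    linarith
  refine ⟨|z|, abs_nonneg z, hself ▸ hmneg, fun x hx => ?_⟩
  rw [heig x]
  exact mul_nonpos_of_nonpos_of_nonneg hmneg.le
    (Finset.sum_nonneg fun i _ => mul_nonneg (abs_nonneg _) (hx i))

variable {W : Type*} [Group W] (cs : CoxeterSystem M W) (hB : IsGeometric M B)

/-- The group preserves each half of the light cone. -/
lemma IsLorentzian.form_rho_neg (hL : IsLorentzian B) {e : S → ℝ} (he : form B e e < 0) (w : W) :
    form B e (rho cs hB w e) < 0 := by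
  induction w using cs.simple_induction_left with
  | one => rwa [rho_one_apply]
  | mul_simple_left w s ih =>
    rw [rho_mul_apply]
    have h1 : form B (rho cs hB w e) (rho cs hB w e) < 0 := by rwa [form_rho]
    -- Compare both through `w e`: its product with its own reflection is its square minus twice the
    -- square of a real number.
    refine hL.form_neg_of_timelike hB h1 he (by rwa [form_rho]) (by rwa [hB.form_comm]) ?_
    rw [rho_simple_apply]
    simp only [map_sub, map_smul, smul_eq_mul]
    nlinarith [mul_self_nonneg (form B (rho cs hB w e) (simpleRoot s))]

end

open Filter Topology

/-! ### Topology of the projective space -/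

section Topology

variable {S : Type*}

lemma tendsto_mk {ι : Type*} {l : Filter ι} {f : ι → S → ℝ} {x : S → ℝ} (hf : ∀ i, f i ≠ 0)
    (hx : x ≠ 0) (h : Tendsto f l (𝓝 x)) :
    Tendsto (fun i => Projectivization.mk ℝ (f i) (hf i)) l (𝓝 (Projectivization.mk ℝ x hx)) := by
  have hc : Continuous (Projectivization.mk' ℝ : {v : S → ℝ // v ≠ 0} → ℙ ℝ (S → ℝ)) :=
    continuous_coinduced_rng
  have h' : Tendsto (fun i => (⟨f i, hf i⟩ : {v : S → ℝ // v ≠ 0})) l (𝓝 ⟨x, hx⟩) :=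
    tendsto_subtype_rng.2 h
  exact (hc.tendsto ⟨x, hx⟩).comp h'

lemma dotProduct_self_ne_zero [Fintype S] {x : S → ℝ} (hx : x ≠ 0) : x ⬝ᵥ x ≠ 0 :=
  fun h => hx (dotProduct_self_eq_zero.1 h)

/-- The matrix of the orthogonal projection onto a line. -/
noncomputable def projMatrix [Fintype S] : ℙ ℝ (S → ℝ) → S → S → ℝ :=
  Projectivization.lift (fun x i j => x.1 i * x.1 j / (x.1 ⬝ᵥ x.1)) (by
    rintro ⟨x, hx⟩ ⟨y, hy⟩ t (rfl : x = t • y)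
    have ht : t ≠ 0 := by
      rintro rfl
      simp at hx
    have := dotProduct_self_ne_zero hy
    ext i j
    simp only [Pi.smul_apply, smul_eq_mul, smul_dotProduct, dotProduct_smul]
    field_simp)

lemma continuous_projMatrix [Fintype S] : Continuous (projMatrix (S := S)) := by
  refine continuous_coinduced_dom.2 ?_
  change Continuous fun (x : {v : S → ℝ // v ≠ 0}) i j => x.1 i * x.1 j / (x.1 ⬝ᵥ x.1)
  refine continuous_pi fun i => continuous_pi fun j => ?_
  have h : ∀ i, Continuous fun x : {v : S → ℝ // v ≠ 0} => x.1 i := fun i =>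
    (continuous_apply i).comp continuous_subtype_val
  exact ((h i).mul (h j)).div (continuous_subtype_val.dotProduct continuous_subtype_val)
    fun x => dotProduct_self_ne_zero x.2

lemma projMatrix_injective [Fintype S] : Function.Injective (projMatrix (S := S)) := by
  intro p q
  induction p using Projectivization.ind with | _ x hx
  induction q using Projectivization.ind with | _ y hy
  intro h
  have h' : ∀ i j, x i * x j / (x ⬝ᵥ x) = y i * y j / (y ⬝ᵥ y) := fun i j =>
    congrFun (congrFun h i) j
  have hxx := dotProduct_self_ne_zero hx
  have hyy := dotProduct_self_ne_zero hy
  obtain ⟨j, hj⟩ := Function.ne_iff.1 hx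
  have hj : x j ≠ 0 := hj
  rw [Projectivization.mk_eq_mk_iff']
  refine ⟨(x ⬝ᵥ x) * y j / ((y ⬝ᵥ y) * x j), ?_⟩
  ext i
  have := h' i j
  simp only [Pi.smul_apply, smul_eq_mul]
  field_simp at this ⊢
  linarith

/-- Uniqueness of the accumulation point needs the Hausdorff property, pulled back from matrices
along the orthogonal projections. -/
instance projT2 [Fintype S] : T2Space (ℙ ℝ (S → ℝ)) :=
  T2Space.of_injective_continuous projMatrix_injective continuous_projMatrix

/-- The only accumulation point of an injective convergent sequence is its limit. -/
lemma derivedSet_range_of_tendsto {X : Type*} [TopologicalSpace X] [T2Space X] {f : ℕ → X} {x : X}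
    (hf : Function.Injective f) (h : Tendsto f atTop (𝓝 x)) : derivedSet (Set.range f) = {x} := by
  ext z
  rw [mem_derivedSet, accPt_iff_nhds, Set.mem_singleton_iff]
  constructor
  · intro hz
    by_contra hne
    obtain ⟨U, V, hU, hV, hzU, hxV, hUV⟩ := t2_separation hne
    obtain ⟨N, hN⟩ := eventually_atTop.1 (h.eventually (hV.mem_nhds hxV))
    -- Besides the tail, only finitely many terms could come near `z`; they are removed from the
    -- neighbourhood, except `z` itself.
    have hfin : (f '' Set.Iio N \ {z}).Finite := ((Set.finite_Iio N).image f).sdiff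
    have hmem : U ∩ (f '' Set.Iio N \ {z})ᶜ ∈ 𝓝 z :=
      inter_mem (hU.mem_nhds hzU) (hfin.isClosed.isOpen_compl.mem_nhds (by simp))
    obtain ⟨_, ⟨⟨hyU, hyN⟩, k, rfl⟩, hyz⟩ := hz _ hmem
    by_cases hk : k < N
    · exact hyN ⟨⟨k, hk, rfl⟩, hyz⟩
    · exact Set.disjoint_left.1 hUV hyU (hN k (not_lt.1 hk))
  · rintro rfl U hU
    obtain ⟨N, hN⟩ := eventually_atTop.1 (h.eventually hU)
    by_cases hz : f N = z
    · refine ⟨f (N + 1), ⟨hN _ (by omega), _, rfl⟩, fun h0 => ?_⟩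
      have := hf (h0.trans hz.symm)
      omega
    · exact ⟨f N, ⟨hN _ le_rfl, _, rfl⟩, hz⟩

end Topology

/-! ### Discreteness of the roots -/

section

variable {S : Type*} [Fintype S] [DecidableEq S] {M : CoxeterMatrix S} {B : Matrix S S ℝ}
  {W : Type*} [Group W] (cs : CoxeterSystem M W) (hB : IsGeometric M B)

variable {cs hB} in
lemma form_self_of_mem_roots {β : S → ℝ} (hβ : β ∈ roots cs hB) : form B β β = 1 := by
  obtain ⟨w, s, rfl⟩ := hβ
  rw [form_rho, form_simpleRoot, hB.diag]

variable {cs hB} in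
lemma ne_zero_of_mem_roots {β : S → ℝ} (hβ : β ∈ roots cs hB) : β ≠ 0 := by
  rintro rfl
  simpa using form_self_of_mem_roots hβ

lemma rho_mem_roots (w : W) {β : S → ℝ} (hβ : β ∈ roots cs hB) : rho cs hB w β ∈ roots cs hB := by
  obtain ⟨v, s, rfl⟩ := hβ
  exact ⟨w * v, s, (rho_mul_apply cs hB w v _).symm⟩

/-- The reflection in a root belongs to the group. -/
lemma exists_rho_eq_reflection {β : S → ℝ} (hβ : β ∈ roots cs hB) :
    ∃ t : W, ∀ x, rho cs hB t x = x - (2 * form B x β) • β := by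
  obtain ⟨w, s, rfl⟩ := hβ
  refine ⟨w * cs.simple s * w⁻¹, fun x => ?_⟩
  rw [rho_mul_apply, rho_mul_apply, rho_simple_apply, map_sub, map_smul, rho_rho_inv_apply,
    form_rho_left, inv_inv]

/-- The chambers of distinct group elements are disjoint. -/
lemma eq_one_of_form_rho_pos {y : S → ℝ} (hy : ∀ s, form B y (simpleRoot s) = 1) {w : W}
    (hw : ∀ s, 0 < form B (rho cs hB w y) (simpleRoot s)) : w = 1 := by
  by_contra hne
  obtain ⟨s, hs⟩ := cs.exists_leftDescent_of_ne_one hne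
  have h := rho_simpleRoot_nonpos cs hB w⁻¹ s (cs.isRightDescent_inv_iff.2 hs)
  have h' := hw s
  rw [form_rho_left, form_eq_sum hy] at h'
  exact absurd (Finset.sum_nonpos fun i _ => h i) (not_le.2 h')

/-- An injective sequence of roots does not converge. -/
lemma not_tendsto_roots (hL : IsLorentzian B) {β : ℕ → S → ℝ} (hβ : ∀ k, β k ∈ roots cs hB)
    (hinj : Function.Injective β) (x : S → ℝ) : ¬ Tendsto β atTop (𝓝 x) := by
  intro hx
  obtain ⟨y, hy⟩ := hL.exists_form_simpleRoot_eq_one hB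
  choose t ht using fun k => exists_rho_eq_reflection cs hB (hβ k)
  have hxx : form B x x = 1 := by
    refine tendsto_nhds_unique (tendsto_form B hx hx) ?_
    simp only [form_self_of_mem_roots (hβ _), tendsto_const_nhds]
  have hx' : Tendsto (fun k => β (k + 1)) atTop (𝓝 x) := hx.comp (tendsto_add_atTop_nat 1)
  -- Reflections in consecutive roots of a convergent sequence nearly cancel, so their product fixes
  -- the open chamber of `y` and is trivial. Then the two roots are proportional, and in fact equal.
  have hlim : Tendsto (fun k => rho cs hB (t k * t (k + 1)) y) atTop (𝓝 y) := by
    have h1 : Tendsto (fun k => y - (2 * form B y (β (k + 1))) • β (k + 1)) atTop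
        (𝓝 (y - (2 * form B y x) • x)) :=
      tendsto_const_nhds.sub
        (((tendsto_form B tendsto_const_nhds hx').const_mul 2).smul hx')
    have h2 := h1.sub (((tendsto_form B h1 hx).const_mul 2).smul hx)
    have h3 : y - (2 * form B y x) • x - (2 * form B (y - (2 * form B y x) • x) x) • x = y := by
      simp only [map_sub, map_smul, LinearMap.sub_apply, LinearMap.smul_apply, smul_eq_mul, hxx]
      module
    rw [h3] at h2
    refine h2.congr fun k => ?_
    rw [rho_mul_apply, ht k, ht (k + 1)]
  have hev : ∀ᶠ k in atTop, ∀ s, 0 < form B (rho cs hB (t k * t (k + 1)) y) (simpleRoot s) := by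
    refine eventually_all.2 fun s => ?_
    refine (tendsto_form B hlim tendsto_const_nhds).eventually (lt_mem_nhds ?_)
    rw [hy]
    exact one_pos
  have hev' : ∀ᶠ k in atTop, 0 < form B (β (k + 1)) (β k) :=
    (tendsto_form B hx' hx).eventually (lt_mem_nhds (by rw [hxx]; exact one_pos))
  obtain ⟨k, hk, hpos⟩ := (hev.and hev').exists
  have h1 := rho_one_apply cs hB (β (k + 1))
  rw [← eq_one_of_form_rho_pos cs hB hy hk, rho_mul_apply, ht (k + 1), ht k,
    form_self_of_mem_roots (hβ (k + 1))] at h1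
  have h2 : β (k + 1) = form B (β (k + 1)) (β k) • β k := by
    simp only [map_sub, map_smul, LinearMap.sub_apply, LinearMap.smul_apply, smul_eq_mul] at h1
    have h3 : (2 : ℝ) • β (k + 1) = (2 : ℝ) • form B (β (k + 1)) (β k) • β k := by
      linear_combination (norm := module) (-1 : ℝ) • h1
    exact smul_right_injective _ two_ne_zero h3
  have h3 := form_self_of_mem_roots (hβ (k + 1))
  generalize form B (β (k + 1)) (β k) = c at h2 hpos
  rw [h2, form_smul_smul, form_self_of_mem_roots (hβ k), mul_one] at h3
  have h4 : c = 1 := by nlinarith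
  rw [h4, one_smul] at h2
  have := hinj h2
  omega

/-- The norms of pairwise distinct roots tend to infinity. -/
lemma tendsto_norm_roots (hL : IsLorentzian B) {β : ℕ → S → ℝ} (hβ : ∀ k, β k ∈ roots cs hB)
    (hinj : Function.Injective β) : Tendsto (fun k => ‖β k‖) atTop atTop := by
  rw [tendsto_atTop]
  intro C
  by_contra hC
  obtain ⟨φ, hφ, hφC⟩ := extraction_of_frequently_atTop (not_eventually.1 hC)
  obtain ⟨x, -, ψ, hψ, hx⟩ := (isCompact_closedBall (0 : S → ℝ) C).tendsto_subseq
    (x := fun k => β (φ k)) (fun k => by simpa using (not_le.1 (hφC k)).le)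
  exact not_tendsto_roots cs hB hL (fun k => hβ _)
    (hinj.comp (hφ.injective.comp hψ.injective)) x hx

end

/-! ### Limit directions of an infinite reduced word -/

section

variable {S : Type*} [Fintype S] [DecidableEq S] {M : CoxeterMatrix S} {B : Matrix S S ℝ}

/-- `u` is an accumulation point of the normalizations of the vectors `x k`. -/
def IsLimitDirection {S : Type*} [Fintype S] (x : ℕ → S → ℝ) (u : S → ℝ) : Prop :=
  ∃ φ : ℕ → ℕ, Tendsto φ atTop atTop ∧
    Tendsto (fun k => ‖x (φ k)‖⁻¹ • x (φ k)) atTop (𝓝 u)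

lemma exists_subseq_tendsto_normalized {S : Type*} [Fintype S] {x : ℕ → S → ℝ}
    (hx : Tendsto (fun k => ‖x k‖) atTop atTop) :
    ∃ φ : ℕ → ℕ, StrictMono φ ∧ ∃ u ≠ 0,
      Tendsto (fun k => ‖x (φ k)‖⁻¹ • x (φ k)) atTop (𝓝 u) := by
  have hnorm : ∀ z : S → ℝ, 0 < ‖z‖ → ‖‖z‖⁻¹ • z‖ = 1 := fun z hz => by
    rw [norm_smul, norm_inv, norm_norm, inv_mul_cancel₀ hz.ne']
  obtain ⟨u, -, φ, hφ, hu⟩ := (isCompact_closedBall (0 : S → ℝ) 1).tendsto_subseq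
    (x := fun k => ‖x k‖⁻¹ • x k) (fun k => by
      rw [mem_closedBall_zero_iff]
      rcases (norm_nonneg (x k)).eq_or_lt with h | h
      · simp [← h]
      · exact (hnorm _ h).le)
  refine ⟨φ, hφ, u, ?_, hu⟩
  have h1 : ‖u‖ = 1 := by
    refine tendsto_nhds_unique hu.norm (tendsto_const_nhds.congr' ?_)
    filter_upwards [(hx.comp hφ.tendsto_atTop).eventually_gt_atTop 0] with k hk
    exact (hnorm _ hk).symm
  rintro rfl
  simp at h1

lemma tendsto_inv_smul_const {S : Type*} [Fintype S] {x : ℕ → S → ℝ}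
    (hx : Tendsto (fun k => ‖x k‖) atTop atTop) (z : S → ℝ) :
    Tendsto (fun k => ‖x k‖⁻¹ • z) atTop (𝓝 0) := by
  simpa using (tendsto_inv_atTop_zero.comp hx).smul_const z

/-- If the products of two diverging sequences are bounded, then the limits of the normalized
sequences are orthogonal. -/
lemma form_eq_zero_of_tendsto {x z : ℕ → S → ℝ} {u v : S → ℝ} {C : ℝ}
    (hx : Tendsto (fun k => ‖x k‖) atTop atTop) (hz : Tendsto (fun k => ‖z k‖) atTop atTop)
    (hu : Tendsto (fun k => ‖x k‖⁻¹ • x k) atTop (𝓝 u))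
    (hv : Tendsto (fun k => ‖z k‖⁻¹ • z k) atTop (𝓝 v))
    (hC : ∀ k, |form B (x k) (z k)| ≤ C) : form B u v = 0 := by
  refine tendsto_nhds_unique (tendsto_form B hu hv) ?_
  have h0 : Tendsto (fun k => ‖x k‖⁻¹ * ‖z k‖⁻¹) atTop (𝓝 0) := by
    simpa using (tendsto_inv_atTop_zero.comp hx).mul (tendsto_inv_atTop_zero.comp hz)
  simp only [form_smul_smul]
  exact h0.zero_mul_isBoundedUnder_le (isBoundedUnder_of ⟨C, fun k => hC k⟩)

variable {W : Type*} [Group W] {cs : CoxeterSystem M W} (hB : IsGeometric M B) {a : ℕ → S}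

lemma invRoot_mem_roots (cs : CoxeterSystem M W) (a : ℕ → S) (k : ℕ) :
    invRoot cs hB a k ∈ roots cs hB := ⟨_, _, rfl⟩

/-- Inversions of an infinite reduced word are pairwise non-proportional. -/
lemma IsInfReduced.mk_invRoot_injective (ha : IsInfReduced cs a) :
    Function.Injective fun k => Projectivization.mk ℝ (invRoot cs hB a k)
      (ne_zero_of_mem_roots (invRoot_mem_roots hB cs a k)) := by
  refine Function.Injective.of_lt_imp_ne fun j k hjk h => ?_
  obtain ⟨c, hc⟩ := (Projectivization.mk_eq_mk_iff' _ _ _ _ _).1 h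
  have h1 := ha.rho_inv_invRoot_nonpos hB hjk
  -- Undoing `w_k` makes the `k`-th inversion simple but the `j`-th one negative, so the factor `c`
  -- is non-positive, although both inversions are non-negative.
  rw [← hc, map_smul, invRoot, rho_inv_rho_apply] at h1
  have hc0 : c ≤ 0 := by simpa [simpleRoot] using h1 (a k)
  refine ne_zero_of_mem_roots (invRoot_mem_roots hB cs a j)
    (le_antisymm ?_ (ha.invRoot_nonneg hB j))
  rw [← hc]
  exact smul_nonpos_of_nonpos_of_nonneg hc0 (ha.invRoot_nonneg hB k)

lemma IsInfReduced.invRoot_injective (ha : IsInfReduced cs a) :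
    Function.Injective (invRoot cs hB a) := by
  intro j k h
  refine ha.mk_invRoot_injective hB ?_
  simp only [h]

lemma proj_invSet (ha : IsInfReduced cs a) :
    proj (invSet cs hB a) = Set.range fun k => Projectivization.mk ℝ (invRoot cs hB a k)
      (ne_zero_of_mem_roots (invRoot_mem_roots hB cs a k)) := by
  ext p
  constructor
  · rintro ⟨_, ⟨-, k, rfl⟩, hx, rfl⟩
    exact ⟨k, rfl⟩
  · rintro ⟨k, rfl⟩
    exact ⟨invRoot cs hB a k,
      ⟨⟨invRoot_mem_roots hB cs a k, ha.invRoot_nonneg hB k⟩, k, rfl⟩, _, rfl⟩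

section Chamber

variable {y : S → ℝ} (hy : ∀ s, form B y (simpleRoot s) = 1)
include hy

/-- A simple reflection subtracts twice its simple root from `y`; the prefix carries this root to an
inversion. -/
lemma rho_prefixElt_eq (k : ℕ) :
    -rho cs hB (prefixElt cs a k) y =
      (2 : ℝ) • ∑ j ∈ Finset.range k, invRoot cs hB a j - y := by
  induction k with
  | zero => simp [prefixElt_zero]
  | succ k ih =>
    rw [prefixElt_succ, rho_mul_apply, rho_simple_apply, hy, map_sub, map_smul, neg_sub,
      sub_eq_add_neg, ih, Finset.sum_range_succ, ← invRoot]
    module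

/-- The sup norm is monotone on non-negative vectors, so the sum of inversions is at least as large
as its last term, a diverging root. -/
lemma tendsto_norm_rho_prefixElt (hL : IsLorentzian B) (ha : IsInfReduced cs a) :
    Tendsto (fun k => ‖-rho cs hB (prefixElt cs a k) y‖) atTop atTop := by
  rw [← tendsto_add_atTop_iff_nat 1]
  have h := tendsto_atTop_add_const_right atTop (-‖y‖)
    (tendsto_norm_roots cs hB hL (invRoot_mem_roots hB cs a) (ha.invRoot_injective hB))
  refine tendsto_atTop_mono (fun k => ?_) h
  rw [rho_prefixElt_eq hB hy]
  refine le_trans ?_ (norm_sub_norm_le _ _)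
  rw [← sub_eq_add_neg]
  gcongr
  have h0 := ha.invRoot_nonneg hB
  have hle : invRoot cs hB a k ≤ (2 : ℝ) • ∑ j ∈ Finset.range (k + 1), invRoot cs hB a j := by
    have h1 := Finset.single_le_sum (f := invRoot cs hB a) (fun j _ => h0 j)
      (Finset.self_mem_range_succ k)
    rw [two_smul]
    exact h1.trans (le_add_of_nonneg_left ((h0 k).trans h1))
  refine (pi_norm_le_iff_of_nonneg (norm_nonneg _)).2 fun i => ?_
  refine le_trans ?_ (norm_le_pi_norm _ i)
  rw [Real.norm_of_nonneg (h0 k i), Real.norm_of_nonneg ((h0 k i).trans (hle i))]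
  exact hle i

lemma form_rho_prefixElt_invRoot (ha : IsInfReduced cs a) {j k : ℕ} (hjk : j < k) :
    form B (rho cs hB (prefixElt cs a k) y) (invRoot cs hB a j) ≤ 0 := by
  rw [form_rho_left, form_eq_sum hy]
  exact Finset.sum_nonpos fun s _ => ha.rho_inv_invRoot_nonpos hB hjk s

lemma IsLimitDirection.form_invRoot_nonneg (ha : IsInfReduced cs a) {u : S → ℝ}
    (hu : IsLimitDirection (fun k => -rho cs hB (prefixElt cs a k) y) u) (j : ℕ) :
    0 ≤ form B u (invRoot cs hB a j) := by
  obtain ⟨φ, hφ, hu⟩ := hu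
  refine ge_of_tendsto (tendsto_form B hu tendsto_const_nhds) ?_
  filter_upwards [hφ.eventually_gt_atTop j] with k hk
  have := form_rho_prefixElt_invRoot hB hy ha hk
  simp only [map_smul, map_neg, LinearMap.smul_apply, LinearMap.neg_apply, smul_eq_mul]
  exact mul_nonneg (by positivity) (by linarith)

section LimitDirection

variable (hL : IsLorentzian B) (ha : IsInfReduced cs a) {u : S → ℝ}
  (hu : IsLimitDirection (fun k => -rho cs hB (prefixElt cs a k) y) u)
include hL ha hu

/-- Adding `y` does not affect the normalized limit and leaves a sum of positive roots. -/
lemma IsLimitDirection.nonneg : 0 ≤ u := by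
  obtain ⟨φ, hφ, hu⟩ := hu
  have h0 := tendsto_inv_smul_const ((tendsto_norm_rho_prefixElt hB hy hL ha).comp hφ) y
  have h1 := hu.add h0
  rw [add_zero] at h1
  refine ge_of_tendsto' h1 fun k => ?_
  beta_reduce
  rw [← smul_add, rho_prefixElt_eq hB hy, sub_add_cancel]
  exact smul_nonneg (by positivity)
    (smul_nonneg zero_le_two (Finset.sum_nonneg fun j _ => ha.invRoot_nonneg hB j))

lemma IsLimitDirection.form_self : form B u u = 0 := by
  obtain ⟨φ, hφ, hu⟩ := hu
  have h := (tendsto_norm_rho_prefixElt hB hy hL ha).comp hφ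
  refine form_eq_zero_of_tendsto (C := |form B y y|) h h hu hu fun k => ?_
  simp only [map_neg, LinearMap.neg_apply, neg_neg, form_rho, le_refl]

/-- The vector `v` is a limit of positive multiples of sums of inversions, each having non-negative
product with `u`. -/
lemma IsLimitDirection.form_nonneg {v : S → ℝ}
    (hv : IsLimitDirection (fun k => -rho cs hB (prefixElt cs a k) y) v) : 0 ≤ form B u v := by
  have hj := hu.form_invRoot_nonneg hB hy ha
  obtain ⟨φ, hφ, hv⟩ := hv
  have h0 := tendsto_inv_smul_const ((tendsto_norm_rho_prefixElt hB hy hL ha).comp hφ) y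
  have h1 := hv.add h0
  rw [add_zero] at h1
  refine ge_of_tendsto' (tendsto_form B tendsto_const_nhds h1) fun k => ?_
  beta_reduce
  rw [← smul_add, rho_prefixElt_eq hB hy, sub_add_cancel, map_smul, map_smul,
    map_sum, smul_eq_mul, smul_eq_mul]
  exact mul_nonneg (by positivity) (mul_nonneg zero_le_two (Finset.sum_nonneg fun j _ => hj j))

lemma IsLimitDirection.form_timelike_neg {e : S → ℝ} (he : form B e e < 0)
    (he' : ∀ x : S → ℝ, 0 ≤ x → form B e x ≤ 0) (hu0 : u ≠ 0) : form B e u < 0 := by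
  refine lt_of_le_of_ne (he' u (hu.nonneg hB hy hL ha)) fun h => ?_
  have := hL.form_self_pos hB he h hu0
  rw [hu.form_self hB hy hL ha] at this
  exact lt_irrefl _ this

/-- Sequences of vectors in bounded position relative to the prefixes of a reduced word converge
projectively to the limit direction of the word. -/
lemma IsLimitDirection.tendsto_mk (hu0 : u ≠ 0) {x : ℕ → S → ℝ} (hx0 : ∀ k, x k ≠ 0)
    (hx : Tendsto (fun k => ‖x k‖) atTop atTop) {C : ℝ} (hxx : ∀ k, |form B (x k) (x k)| ≤ C)
    {ψ : ℕ → ℕ} (hψ : Tendsto ψ atTop atTop)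
    (hyx : ∀ k, |form B (rho cs hB (prefixElt cs a (ψ k)) y) (x k)| ≤ C) :
    Tendsto (fun k => Projectivization.mk ℝ (x k) (hx0 k)) atTop
      (𝓝 (Projectivization.mk ℝ u hu0)) := by
  obtain ⟨e, -, he, he'⟩ := hL.exists_nonneg_timelike hB
  have hd := tendsto_norm_rho_prefixElt hB hy hL ha
  refine tendsto_of_subseq_tendsto fun ns hns => ?_
  have hd₁ : Tendsto (fun k => ‖-rho cs hB (prefixElt cs a (ψ (ns k))) y‖) atTop atTop :=
    hd.comp (hψ.comp hns)
  obtain ⟨φ, hφ, u', hu'0, hu'⟩ := exists_subseq_tendsto_normalized hd₁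
  have hx₁ : Tendsto (fun k => ‖x (ns (φ k))‖) atTop atTop :=
    hx.comp (hns.comp hφ.tendsto_atTop)
  obtain ⟨φ', hφ', v, hv0, hv⟩ := exists_subseq_tendsto_normalized hx₁
  have hx₂ := hx₁.comp hφ'.tendsto_atTop
  have hlim' : IsLimitDirection (fun k => -rho cs hB (prefixElt cs a k) y) u' :=
    ⟨fun k => ψ (ns (φ k)), hψ.comp (hns.comp hφ.tendsto_atTop), hu'⟩
  have hvv : form B v v = 0 := form_eq_zero_of_tendsto hx₂ hx₂ hv hv fun k => hxx _
  have huv : form B u' v = 0 := by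
    refine form_eq_zero_of_tendsto (C := C) 
      (hd₁.comp (hφ.tendsto_atTop.comp hφ'.tendsto_atTop)) hx₂
      (hu'.comp hφ'.tendsto_atTop) hv fun k => ?_
    simpa only [map_neg, LinearMap.neg_apply, abs_neg, Function.comp_apply] using hyx (ns (φ (φ' k)))
  have hu's := hlim'.form_self hB hy hL ha
  have heu := hu.form_timelike_neg hB hy hL ha he he' hu0
  have heu' := hlim'.form_timelike_neg hB hy hL ha he he' hu'0
  -- `v` is orthogonal to the limit `u'` along the same indices; `u'` is in turn proportional to
  -- `u`, as both are limit directions of the word.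
  have h1 := hL.smul_eq_smul_of_isotropic hB he hu's hvv (by rw [huv, mul_zero])
  have h2 := hL.smul_eq_smul_of_isotropic hB he (hu.form_self hB hy hL ha) hu's
    (mul_nonneg (mul_pos_of_neg_of_neg heu heu').le (hu.form_nonneg hB hy hL ha hlim'))
  have hmk : Projectivization.mk ℝ v hv0 = Projectivization.mk ℝ u hu0 := by
    rw [Projectivization.mk_eq_mk_iff']
    refine ⟨form B e v / form B e u, ?_⟩
    have h3 : u = (form B e u')⁻¹ • form B e u • u' := by
      rw [h2, inv_smul_smul₀ heu'.ne]
    have h4 : v = (form B e u')⁻¹ • form B e v • u' := by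
      rw [← h1, inv_smul_smul₀ heu'.ne]
    generalize form B e v = c at h1 h4 ⊢
    generalize form B e u = d at *
    rw [h3, h4, smul_comm _ d, smul_smul _ d, div_mul_cancel₀ _ heu.ne, smul_comm]
  refine ⟨fun k => φ (φ' k), ?_⟩
  rw [← hmk]
  refine (GeomCox.tendsto_mk (fun k => ?_) hv0 hv).congr fun k => ?_
  · exact smul_ne_zero (inv_ne_zero (norm_ne_zero_iff.2 (hx0 _))) (hx0 _)
  · rw [Projectivization.mk_eq_mk_iff']
    exact ⟨_, rfl⟩

end LimitDirection

/-- Distinct prefixes move the line of a point of the fundamental chamber to distinct lines. -/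
lemma mk_rho_prefixElt_injective (hL : IsLorentzian B) (ha : IsInfReduced cs a) (hy0 : y ≠ 0) :
    Function.Injective fun k =>
      rho cs hB (prefixElt cs a k) • Projectivization.mk ℝ y hy0 := by
  obtain ⟨e, he0, he, he'⟩ := hL.exists_nonneg_timelike hB
  refine Function.Injective.of_lt_imp_ne fun j k hjk h => ?_
  obtain ⟨c, hc⟩ := (Projectivization.mk_eq_mk_iff' _ _ _ _ _).1 h
  change c • rho cs hB (prefixElt cs a k) y = rho cs hB (prefixElt cs a j) y at hc
  -- The `j`-th inversion is positive on `w_j y` and non-positive on `w_k y`, so the lines can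
  -- coincide only with opposite orientation.
  have hcneg : c < 0 := by
    have h1 : form B (rho cs hB (prefixElt cs a j) y) (invRoot cs hB a j) = 1 := by
      rw [invRoot, form_rho, hy]
    rw [← hc, map_smul, LinearMap.smul_apply, smul_eq_mul] at h1
    have := form_rho_prefixElt_invRoot hB hy ha hjk
    by_contra! hc0
    nlinarith
  set g := (prefixElt cs a k)⁻¹ * prefixElt cs a j with hg
  have hgy : rho cs hB g y = c • y := by
    rw [hg, rho_mul_apply, ← hc, map_smul, rho_inv_rho_apply]
  have hroot : ∀ s, rho cs hB g⁻¹ (simpleRoot s) ≤ 0 := by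
    intro s
    by_cases hs : cs.IsRightDescent g⁻¹ s
    · exact rho_simpleRoot_nonpos cs hB _ _ hs
    · exfalso
      have h1 := form_rho_left cs hB g y (simpleRoot s)
      rw [hgy, map_smul, LinearMap.smul_apply, hy, smul_eq_mul, mul_one, form_eq_sum hy] at h1
      have h2 : 0 ≤ ∑ i, rho cs hB g⁻¹ (simpleRoot s) i :=
        Finset.sum_nonneg fun i _ => rho_simpleRoot_nonneg cs hB _ _ hs i
      linarith
  -- An element reversing `y` makes all simple roots negative, and so sends the non-negative
  -- timelike `e` to the opposite half of the light cone, which is impossible.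
  have hge : rho cs hB g⁻¹ e ≤ 0 := by
    rw [pi_eq_sum_univ' e, map_sum]
    refine Finset.sum_nonpos fun s _ => ?_
    rw [map_smul]
    exact smul_nonpos_of_nonneg_of_nonpos (he0 s) (hroot s)
  have h1 := hL.form_rho_neg cs hB he g⁻¹
  have h2 := he' _ (neg_nonneg.2 hge)
  rw [map_neg] at h2
  linarith

end Chamber

end

end GeomCox

/-! ### The main theorem -/

theorem mainTheorem4 {S W : Type*} [Fintype S] [DecidableEq S] [Group W]
    {M : CoxeterMatrix S} (cs : CoxeterSystem M W)
    {B : Matrix S S ℝ} (hB : GeomCox.IsGeometric M B) (hL : GeomCox.IsLorentzian B)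
    (a : ℕ → S) (ha : GeomCox.IsInfReduced cs a) :
    ∃ γ ∈ GeomCox.limitRoots cs hB,
      derivedSet (GeomCox.proj (GeomCox.invSet cs hB a)) = {γ} ∧
      (∃ p : ℙ ℝ (S → ℝ), GeomCox.ArisesFromThrough γ p
        (fun k => GeomCox.rho cs hB (GeomCox.prefixElt cs a k))) ∧
      (∀ p ∈ GeomCox.proj (GeomCox.roots cs hB), ∀ φ : ℕ → ℕ, StrictMono φ →
        Function.Injective
          (fun k => GeomCox.rho cs hB (GeomCox.prefixElt cs a (φ k)) • p) →
        GeomCox.ArisesFromThrough γ p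
          (fun k => GeomCox.rho cs hB (GeomCox.prefixElt cs a (φ k)))) := by
  open GeomCox Filter Topology in
  obtain ⟨y, hy⟩ := hL.exists_form_simpleRoot_eq_one hB
  have hd := tendsto_norm_rho_prefixElt hB hy hL ha
  obtain ⟨φ₀, hφ₀, u, hu0, hlim⟩ := exists_subseq_tendsto_normalized hd
  have hu : IsLimitDirection (fun k => -rho cs hB (prefixElt cs a k) y) u :=
    ⟨φ₀, hφ₀.tendsto_atTop, hlim⟩
  have hy0 : y ≠ 0 := by
    rintro rfl
    simpa using hy (a 0)
  have hinv : derivedSet (proj (invSet cs hB a)) = {Projectivization.mk ℝ u hu0} := by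
    rw [proj_invSet hB ha]
    refine derivedSet_range_of_tendsto (ha.mk_invRoot_injective hB) ?_
    -- `C = 1` serves twice: roots have square `1`, and the `k`-th inversion has product `1` with
    -- `w_k y`.
    refine hu.tendsto_mk hB hy hL ha hu0 _ (tendsto_norm_roots cs hB hL
      (invRoot_mem_roots hB cs a) (ha.invRoot_injective hB)) (C := 1) (fun k => ?_)
      tendsto_id (fun k => ?_)
    · rw [form_self_of_mem_roots (invRoot_mem_roots hB cs a k), abs_one]
    · rw [id, invRoot, form_rho, hy, abs_one]
  refine ⟨Projectivization.mk ℝ u hu0, ?_, hinv, ⟨Projectivization.mk ℝ y hy0, ?_, ?_⟩, ?_⟩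
  · have h1 : Projectivization.mk ℝ u hu0 ∈ derivedSet (proj (invSet cs hB a)) := by
      rw [hinv]
      rfl
    refine derivedSet_mono _ _ ?_ h1
    rintro _ ⟨x, hx, hx0, rfl⟩
    exact ⟨x, hx.1.1, hx0, rfl⟩
  · exact mk_rho_prefixElt_injective hB hy hL ha hy0
  · refine hu.tendsto_mk hB hy hL ha hu0 (x := fun k => rho cs hB (prefixElt cs a k) y)
      (fun k => (LinearEquiv.map_ne_zero_iff _).2 hy0) (by simpa only [norm_neg] using hd)
      (C := |form B y y|) (fun k => ?_) tendsto_id (fun k => ?_)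
    · rw [form_rho]
    · rw [id, form_rho]
  · rintro _ ⟨β, hβ, hβ0, rfl⟩ φ hφ hinj
    refine ⟨hinj, ?_⟩
    have hroots : ∀ k, rho cs hB (prefixElt cs a (φ k)) β ∈ roots cs hB :=
      fun k => rho_mem_roots cs hB _ hβ
    have hinj' : Function.Injective fun k => rho cs hB (prefixElt cs a (φ k)) β := by
      intro j k h
      refine hinj ?_
      refine (Projectivization.mk_eq_mk_iff' _ _ _ _ _).2 ⟨1, ?_⟩
      rw [one_smul]
      exact h.symm
    -- By invariance the product of `w_k y` with `w_k β` is constantly that of `y` with `β`.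
    refine hu.tendsto_mk hB hy hL ha hu0 (x := fun k => rho cs hB (prefixElt cs a (φ k)) β)
      (fun k => ne_zero_of_mem_roots (hroots k)) (tendsto_norm_roots cs hB hL hroots hinj')
      (C := max 1 |form B y β|) (fun k => ?_) hφ.tendsto_atTop (fun k => ?_)
    · rw [form_self_of_mem_roots (hroots k), abs_one]
      exact le_max_left _ _
    · rw [form_rho]
      exact le_max_right _ _
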